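/- All graphs are finite and simple. Let $X$ and $Y$ be graphs with adjacency matrices $A$ and $B$. A matrix $U=(u_{ij})$ with entries in a unital $C^*$-algebra is a *magic unitary* if every entry is a projection ($u_{ij}=u_{ij}^*=u_{ij}^2$) and every row and every column sums to $1$. The graphs $X$ and $Y$ are *quantum isomorphic* if there are a nonzero complex Hilbert space $\mathcal H$ and a magic unitary $U=(u_{xy})_{x\in V(X),\,y\in V(Y)}$ with entries in $\mathcal B(\mathcal H)$ such that $AU=UB$. The quantum symmetry algebra $C(\mathrm{Qut}(X))$ is the universal $C^*$-algebra generated by elements $u_{xy}$, $x,y\in V(X)$, subject to the relations that $(u_{xy})$ is a magic unitary with $A(u_{xy})=(u_{xy})A$. The *quantum orbits* of $X$ are the equivalence classes of the relation $x\sim_1 y\iff u_{xy}\neq 0$ on $V(X)$, and the *quantum orbitals* of $X$ are the equivalence classes of the relation $(x,x')\sim_2(y,y')\iff u_{xy}u_{x'y'}\neq 0$ on $V(X)\times V(X)$. The *quantum orbital algebra* of $X$ is the linear span of the characteristic $01$-matrices of the quantum orbitals; it is a coherent algebra, i.e. a self-adjoint unital algebra of complex matrices that contains the all-ones matrix $J$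 and is closed under the Schur (entrywise) product $\circ$. An *isomorphism* of coherent algebras is a linear bijection $\Phi$ with $\Phi(MN)=\Phi(M)\Phi(N)$, $\Phi(M^*)=\Phi(M)^*$, $\Phi(M\circ N)=\Phi(M)\circ\Phi(N)$, $\Phi(I)=I$ and $\Phi(J)=J$. **Theorem.** Suppose that $X$ and $Y$ are quantum isomorphic. Then $A$ and $B$ belong to the quantum orbital algebras of $X$ and $Y$ respectively, and there is an isomorphism $\Phi$ of coherent algebras from the quantum orbital algebra of $X$ to that of $Y$ such that $\Phi(A)=B$. Moreover, $X$ and $Y$ have the same number of quantum orbits. -/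

import Mathlib

open scoped Matrix ENNReal

universe u v w

/-- A matrix over a unital *-ring is a *magic unitary* if its entries are projections
(`p = p* = p²`) and each of its rows and columns sums to `1`. -/
structure IsMagicUnitary {V W R : Type*} [Fintype V] [Fintype W] [Ring R] [StarRing R]
    (U : Matrix V W R) : Prop where
  proj : ∀ x y, IsStarProjection (U x y)
  row_sum : ∀ x, ∑ y, U x y = 1
  col_sum : ∀ y, ∑ x, U x y = 1

/-- Quantum isomorphism of finite graphs: there are a nonzero complex Hilbert space `H` and a
magic unitary `U` with entries in the bounded operators on `H` such that `A U = U B`, where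
`A` and `B` are the adjacency matrices (whose scalar entries `0`, `1` act as `0`, `1` in
`B(H)`). -/
def QuantumIsomorphic {V : Type u} {W : Type v} [Fintype V] [Fintype W]
    (X : SimpleGraph V) (Y : SimpleGraph W) [DecidableRel X.Adj] [DecidableRel Y.Adj] : Prop :=
  ∃ (H : Type w) (_ : NormedAddCommGroup H) (_ : InnerProductSpace ℂ H) (_ : CompleteSpace H)
    (_ : Nontrivial H) (U : Matrix V W (H →L[ℂ] H)),
    IsMagicUnitary U ∧ X.adjMatrix (H →L[ℂ] H) * U = U * Y.adjMatrix (H →L[ℂ] H)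

/-! ### The quantum symmetry algebra of a graph -/

/-- A representation on a (nonzero) Hilbert space of the relations defining the quantum
automorphism group of `X`: a magic unitary of operators which commutes with the adjacency
matrix. -/
structure QutRep {V : Type u} [Fintype V] (X : SimpleGraph V) [DecidableRel X.Adj] :
    Type (max u 1) where
  /-- the Hilbert space -/
  H : Type
  [normed : NormedAddCommGroup H]
  [inner : InnerProductSpace ℂ H]
  [complete : CompleteSpace H]
  [nontriv : Nontrivial H]
  /-- the magic unitary -/
  U : Matrix V V (H →L[ℂ] H)
  magic : IsMagicUnitary U
  comm : X.adjMatrix (H →L[ℂ] H) * U = U * X.adjMatrix (H →L[ℂ] H)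

attribute [instance] QutRep.normed QutRep.inner QutRep.complete QutRep.nontriv

section

variable {V : Type*} [Fintype V] (X : SimpleGraph V) [DecidableRel X.Adj]

/-- The C*-algebra of bounded families `(T π)`, where `π` runs over all representations of the
defining relations and `T π` is an operator on the Hilbert space of `π`. -/
noncomputable abbrev QutProduct := lp (fun π : QutRep X => π.H →L[ℂ] π.H) ∞

/-- The family of the `(x, y)` entries of all representations. -/
noncomputable def qutGen (x y : V) : QutProduct X :=
  ⟨fun π => π.U x y, memℓp_infty ⟨1, by
    rintro _ ⟨π, rfl⟩
    exact (π.magic.proj x y).norm_le⟩⟩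

/-- The quantum symmetry algebra `C(Qut(X))`: the universal C*-algebra generated by elements
`u x y` subject to the relations that `(u x y)` is a magic unitary which commutes with the
adjacency matrix. It is constructed as the closed unital *-subalgebra generated by the entries
of the direct sum of all representations of the relations. (Finitely generated C*-algebras are
separable, so Hilbert spaces in `Type` are enough to compute the universal norm.) -/
noncomputable def quantumSymmetryAlgebra : StarSubalgebra ℂ (QutProduct X) :=
  (StarAlgebra.adjoin ℂ (Set.range fun p : V × V => qutGen X p.1 p.2)).topologicalClosure

/-- The canonical generators of `C(Qut(X))`, arranged in a matrix. -/
noncomputable def qutMatrix : Matrix V V (quantumSymmetryAlgebra X) := fun x y =>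
  ⟨qutGen X x y, StarSubalgebra.le_topologicalClosure _
    (StarAlgebra.subset_adjoin ℂ _ ⟨(x, y), rfl⟩)⟩

/-! ### Quantum orbits, quantum orbitals and the quantum orbital algebra -/

/-- `x ∼₁ y` if `u x y ≠ 0` in `C(Qut(X))`. -/
def QuantumOrbitRel (x y : V) : Prop := qutMatrix X x y ≠ 0

/-- `(x, x') ∼₂ (y, y')` if `u x y * u x' y' ≠ 0` in `C(Qut(X))`. -/
def QuantumOrbitalRel (p q : V × V) : Prop :=
  qutMatrix X p.1 q.1 * qutMatrix X p.2 q.2 ≠ 0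

/-- The quantum orbits of `X`: the classes of `∼₁`. -/
def quantumOrbits : Set (Set V) := Set.range fun x => {y | QuantumOrbitRel X x y}

/-- The quantum orbitals of `X`: the classes of `∼₂`. -/
def quantumOrbitals : Set (Set (V × V)) := Set.range fun p => {q | QuantumOrbitalRel X p q}

/-- The characteristic matrix of a relation. -/
noncomputable def charMatrix {V : Type*} (R : Set (V × V)) : Matrix V V ℂ :=
  Matrix.of fun x y => R.indicator (fun _ => (1 : ℂ)) (x, y)

/-- The quantum orbital algebra of `X`: the linear span of the characteristic matrices of the
quantum orbitals. -/
noncomputable def quantumOrbitalAlgebra : Submodule ℂ (Matrix V V ℂ) :=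
  Submodule.span ℂ (charMatrix '' quantumOrbitals X)

end

/-! ### Coherent algebras -/

/-- A coherent algebra: a self-adjoint unital algebra of complex matrices which contains the all
ones matrix and is closed under the Schur (entrywise) product. -/
structure IsCoherentAlgebra {V : Type*} [Fintype V] [DecidableEq V]
    (C : Submodule ℂ (Matrix V V ℂ)) : Prop where
  one_mem : (1 : Matrix V V ℂ) ∈ C
  allOnes_mem : (Matrix.of fun _ _ => (1 : ℂ)) ∈ C
  mul_mem : ∀ {M N : Matrix V V ℂ}, M ∈ C → N ∈ C → M * N ∈ C
  conjTranspose_mem : ∀ {M : Matrix V V ℂ}, M ∈ C → Mᴴ ∈ C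
  hadamard_mem : ∀ {M N : Matrix V V ℂ}, M ∈ C → N ∈ C → M ⊙ N ∈ C

/-- An isomorphism of coherent algebras: a linear bijection which preserves the matrix product,
the adjoint, the Schur product, the identity matrix and the all ones matrix. -/
structure IsCoherentAlgebraIso {V W : Type*} [Fintype V] [DecidableEq V] [Fintype W]
    [DecidableEq W] {C : Submodule ℂ (Matrix V V ℂ)} {D : Submodule ℂ (Matrix W W ℂ)}
    (hC : IsCoherentAlgebra C) (hD : IsCoherentAlgebra D) (Φ : C ≃ₗ[ℂ] D) : Prop where
  map_mul : ∀ M N : C, Φ ⟨M.1 * N.1, hC.mul_mem M.2 N.2⟩ =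
    ⟨(Φ M).1 * (Φ N).1, hD.mul_mem (Φ M).2 (Φ N).2⟩
  map_conjTranspose : ∀ M : C, Φ ⟨M.1ᴴ, hC.conjTranspose_mem M.2⟩ =
    ⟨(Φ M).1ᴴ, hD.conjTranspose_mem (Φ M).2⟩
  map_hadamard : ∀ M N : C, Φ ⟨M.1 ⊙ N.1, hC.hadamard_mem M.2 N.2⟩ =
    ⟨(Φ M).1 ⊙ (Φ N).1, hD.hadamard_mem (Φ M).2 (Φ N).2⟩
  map_one : Φ ⟨1, hC.one_mem⟩ = ⟨1, hD.one_mem⟩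
  map_allOnes : Φ ⟨Matrix.of fun _ _ => 1, hC.allOnes_mem⟩ =
    ⟨Matrix.of fun _ _ => 1, hD.allOnes_mem⟩

open scoped TensorProduct InnerProductSpace

/-! Call a pair of vertices of `X` and a pair of vertices of `Y` related when `U x y * U x' y' ≠ 0`
for some magic unitary `U` with `A U = U B` (`IntertwinerRel`). Such unitaries transpose, and
compose on tensor products (`comp`, `comp_mul_ne_zero`), so relatedness is symmetric and transitive.
For `X = Y` it is the orbital relation. For quantum isomorphic graphs every pair has a partner,
because rows and columns sum to `1 ≠ 0`; hence relatedness matches the orbitals of `X` with those of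
`Y`.

Matrices `M` and `N` that agree on related pairs are exactly those intertwined by every magic
unitary that intertwines `A` and `B` (`isMagicIntertwiner`, `of_forall`). Agreement is visibly
stable under Schur products and adjoints, intertwining under matrix products. Transporting entries
along related pairs is therefore an isomorphism of coherent algebras, and it sends `A` to `B`.
Restriction to diagonal pairs gives the statement on orbits.

Incomplete inner product spaces are allowed throughout, so the algebraic tensor product suffices;
completion is needed only to return to representations on Hilbert spaces. -/

/-! ### Symmetric projections and tensor products of operators. -/

theorem LinearMap.IsSymmetricProjection.inner_map_self {E : Type*} [NormedAddCommGroup E]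
    [InnerProductSpace ℂ E] {P : Module.End ℂ E} (hP : P.IsSymmetricProjection) (v : E) :
    ⟪P v, v⟫_ℂ = (‖P v‖ ^ 2 : ℝ) := by
  have h : P (P v) = P v := congr($(hP.isIdempotentElem) v)
  rw [← h, hP.isSymmetric (P v) v, inner_self_eq_norm_sq_to_K, h]
  simp

/-- Symmetric projections which sum to `1` are mutually orthogonal. -/
theorem LinearMap.IsSymmetricProjection.mul_eq_zero_of_sum_eq_one {E ι : Type*}
    [NormedAddCommGroup E] [InnerProductSpace ℂ E] [Fintype ι] {P : ι → Module.End ℂ E}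
    (hP : ∀ i, (P i).IsSymmetricProjection) (hsum : ∑ i, P i = 1) {i j : ι} (hij : i ≠ j) :
    P i * P j = 0 := by
  classical
  ext v
  have hj : P j (P j v) = P j v := congr($((hP j).isIdempotentElem) v)
  set x := P j v
  have hx : ∑ k, P k x = x := by simpa using congr($hsum x)
  -- For `x` in the range of `P j`, the term `k = j` already exhausts `‖x‖ ^ 2`, so all others
  -- vanish.
  have hn : ∑ k, ‖P k x‖ ^ 2 = ‖x‖ ^ 2 := by
    have h := congr(⟪$hx, x⟫_ℂ)
    simp only [sum_inner, (hP _).inner_map_self, inner_self_eq_norm_sq_to_K] at h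
    exact Complex.ofReal_injective (by push_cast at h ⊢; exact h)
  rw [← Finset.add_sum_erase _ _ (Finset.mem_univ j), hj] at hn
  have h0 : ∑ k ∈ Finset.univ.erase j, ‖P k x‖ ^ 2 = 0 := by linarith
  rw [Finset.sum_eq_zero_iff_of_nonneg fun _ _ => by positivity] at h0
  simpa using h0 i (by simp [hij])

theorem LinearMap.IsSymmetric.mul_eq_zero_comm {E : Type*} [NormedAddCommGroup E]
    [InnerProductSpace ℂ E] {P Q : Module.End ℂ E} (hP : P.IsSymmetric) (hQ : Q.IsSymmetric)
    (h : P * Q = 0) : Q * P = 0 := by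
  ext v
  refine ext_inner_right ℂ fun w => ?_
  have h' : P (Q w) = 0 := congr($h w)
  simp [hQ (P v) w, hP v (Q w), h']

theorem LinearMap.IsSymmetric.tensorProduct_map {E F : Type*} [NormedAddCommGroup E]
    [InnerProductSpace ℂ E] [NormedAddCommGroup F] [InnerProductSpace ℂ F]
    {P : Module.End ℂ E} {Q : Module.End ℂ F} (hP : P.IsSymmetric) (hQ : Q.IsSymmetric) :
    (TensorProduct.map P Q).IsSymmetric := by
  intro a b
  induction a with
  | zero => simp
  | add a a' h h' => simp [inner_add_left, h, h']
  | tmul e f =>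
    induction b with
    | zero => simp
    | add b b' h h' => rw [inner_add_right, h, h', map_add, inner_add_right]
    | tmul e' f' => simp [hP e e', hQ f f']

theorem TensorProduct.map_sum_left {E E' F F' ι : Type*} [AddCommGroup E] [Module ℂ E]
    [AddCommGroup E'] [Module ℂ E'] [AddCommGroup F] [Module ℂ F] [AddCommGroup F'] [Module ℂ F']
    (s : Finset ι) (f : ι → E →ₗ[ℂ] E') (g : F →ₗ[ℂ] F') :
    TensorProduct.map (∑ i ∈ s, f i) g = ∑ i ∈ s, TensorProduct.map (f i) g :=
  map_sum ((TensorProduct.mapBilinear (.id ℂ) E F E' F').flip g) f s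

theorem TensorProduct.map_sum_right {E E' F F' ι : Type*} [AddCommGroup E] [Module ℂ E]
    [AddCommGroup E'] [Module ℂ E'] [AddCommGroup F] [Module ℂ F] [AddCommGroup F'] [Module ℂ F']
    (s : Finset ι) (f : E →ₗ[ℂ] E') (g : ι → F →ₗ[ℂ] F') :
    TensorProduct.map f (∑ i ∈ s, g i) = ∑ i ∈ s, TensorProduct.map f (g i) :=
  map_sum (TensorProduct.mapBilinear (.id ℂ) E F E' F' f) g s

theorem TensorProduct.map_ne_zero {E F : Type*} [NormedAddCommGroup E]
    [InnerProductSpace ℂ E] [NormedAddCommGroup F] [InnerProductSpace ℂ F]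
    {P : Module.End ℂ E} {Q : Module.End ℂ F} (hP : P ≠ 0) (hQ : Q ≠ 0) :
    TensorProduct.map P Q ≠ 0 := by
  obtain ⟨e, he⟩ := DFunLike.ne_iff.mp hP
  obtain ⟨f, hf⟩ := DFunLike.ne_iff.mp hQ
  intro h
  have h' : ‖P e ⊗ₜ[ℂ] Q f‖ = 0 := by
    rw [← TensorProduct.map_tmul, h, LinearMap.zero_apply, norm_zero]
  rw [TensorProduct.norm_tmul] at h'
  simp_all

/-! ### Magic intertwiners. -/

section
variable {V : Type*} {W : Type*} {Z : Type*} [Fintype V] [Fintype W] [Fintype Z]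

/-- A magic unitary of linear operators on an inner product space which intertwines the scalar
matrices `A` and `B`. -/
structure IsMagicIntertwiner (A : Matrix V V ℂ) (B : Matrix W W ℂ) {E : Type*}
    [NormedAddCommGroup E] [InnerProductSpace ℂ E] (U : V → W → Module.End ℂ E) : Prop where
  proj : ∀ x y, (U x y).IsSymmetricProjection
  row_sum : ∀ x, ∑ y, U x y = 1
  col_sum : ∀ y, ∑ x, U x y = 1
  comm : ∀ x y, ∑ z, A x z • U z y = ∑ z, B z y • U x z

namespace IsMagicIntertwiner

variable {A : Matrix V V ℂ} {B : Matrix W W ℂ} {C : Matrix Z Z ℂ} {E F : Type*}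
  [NormedAddCommGroup E] [InnerProductSpace ℂ E] [NormedAddCommGroup F] [InnerProductSpace ℂ F]
  {U : V → W → Module.End ℂ E}

theorem mul_self (hU : IsMagicIntertwiner A B U) (x : V) (y : W) : U x y * U x y = U x y :=
  (hU.proj x y).isIdempotentElem

theorem row_orthogonal (hU : IsMagicIntertwiner A B U) (x : V) {y y' : W} (h : y ≠ y') :
    U x y * U x y' = 0 :=
  LinearMap.IsSymmetricProjection.mul_eq_zero_of_sum_eq_one (hU.proj x) (hU.row_sum x) h

theorem col_orthogonal (hU : IsMagicIntertwiner A B U) {x x' : V} (h : x ≠ x') (y : W) :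
    U x y * U x' y = 0 :=
  LinearMap.IsSymmetricProjection.mul_eq_zero_of_sum_eq_one (P := fun x => U x y)
    (fun x => hU.proj x y) (hU.col_sum y) h

theorem transpose (hA : A.IsSymm) (hB : B.IsSymm) (hU : IsMagicIntertwiner A B U) :
    IsMagicIntertwiner B A fun y x => U x y where
  proj y x := hU.proj x y
  row_sum := hU.col_sum
  col_sum := hU.row_sum
  comm y x := by
    simp_rw [fun z => hB.apply z y, fun z => hA.apply x z, hU.comm]

theorem refl [DecidableEq V] (A : Matrix V V ℂ) (E : Type*) [NormedAddCommGroup E]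
    [InnerProductSpace ℂ E] :
    IsMagicIntertwiner A A fun x y => if x = y then (1 : Module.End ℂ E) else 0 where
  proj x y := by
    split_ifs
    · exact ⟨IsIdempotentElem.one, LinearMap.IsSymmetric.id⟩
    · exact ⟨IsIdempotentElem.zero, LinearMap.IsSymmetric.zero⟩
  row_sum x := by simp
  col_sum x := by simp
  comm x y := by simp

/-- The composition of two magic intertwiners, acting on the tensor product. -/
theorem comp (hU : IsMagicIntertwiner A B U) {U' : W → Z → Module.End ℂ F}
    (hU' : IsMagicIntertwiner B C U') :
    IsMagicIntertwiner A C fun x z => ∑ y, TensorProduct.map (U x y) (U' y z) where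
  proj x z := by
    refine ⟨?_, ?_⟩
    · classical
      change (∑ y, TensorProduct.map (U x y) (U' y z)) * (∑ y, TensorProduct.map (U x y) (U' y z))
        = _
      simp_rw [Finset.sum_mul, Finset.mul_sum, ← TensorProduct.map_mul]
      refine Finset.sum_congr rfl fun y _ => ?_
      rw [Finset.sum_eq_single y]
      · rw [hU.mul_self, hU'.mul_self]
      · intro y' _ h
        rw [hU.row_orthogonal x h.symm, TensorProduct.map_zero_left]
      · simp
    · refine Finset.sum_induction _ LinearMap.IsSymmetric (fun _ _ h h' => h.add h')
        LinearMap.IsSymmetric.zero fun y _ => ?_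
      exact (hU.proj x y).isSymmetric.tensorProduct_map (hU'.proj y z).isSymmetric
  row_sum x := by
    rw [Finset.sum_comm]
    simp_rw [← TensorProduct.map_sum_right, hU'.row_sum]
    rw [← TensorProduct.map_sum_left, hU.row_sum, TensorProduct.map_one]
  col_sum z := by
    rw [Finset.sum_comm]
    simp_rw [← TensorProduct.map_sum_left, hU.col_sum]
    rw [← TensorProduct.map_sum_right, hU'.col_sum, TensorProduct.map_one]
  comm x z := by
    calc ∑ z', A x z' • ∑ y, TensorProduct.map (U z' y) (U' y z)
        = ∑ y, TensorProduct.map (∑ z', A x z' • U z' y) (U' y z) := by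
          simp_rw [Finset.smul_sum, ← TensorProduct.map_smul_left]
          rw [Finset.sum_comm]
          simp_rw [← TensorProduct.map_sum_left]
      _ = ∑ y, TensorProduct.map (U x y) (∑ y', B y y' • U' y' z) := by
          simp_rw [hU.comm, TensorProduct.map_sum_left, TensorProduct.map_smul_left,
            TensorProduct.map_sum_right, TensorProduct.map_smul_right]
          rw [Finset.sum_comm]
      _ = ∑ t, C t z • ∑ y, TensorProduct.map (U x y) (U' y t) := by
          simp_rw [hU'.comm, Finset.smul_sum, ← TensorProduct.map_smul_right]
          rw [Finset.sum_comm]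
          simp_rw [← TensorProduct.map_sum_right]

/-- Multiplying by `U x y ⊗ 1` on the left and `U x' y' ⊗ 1` on the right isolates one summand of
each factor. What remains is the tensor product of the two given nonzero operators. -/
theorem comp_mul_ne_zero {T : Type*} (hU : IsMagicIntertwiner A B U) {U' : W → T → Module.End ℂ F}
    {x x' : V} {y y' : W} {z z' : T} (h : U x y * U x' y' ≠ 0) (h' : U' y z * U' y' z' ≠ 0) :
    (∑ y, TensorProduct.map (U x y) (U' y z)) * (∑ y, TensorProduct.map (U x' y) (U' y z'))
      ≠ 0 := by
  have hl : TensorProduct.map (U x y) 1 * (∑ y, TensorProduct.map (U x y) (U' y z)) =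
      TensorProduct.map (U x y) (U' y z) := by
    rw [Finset.mul_sum, Finset.sum_eq_single y]
    · rw [← TensorProduct.map_mul, hU.mul_self, one_mul]
    · intro w _ hw
      rw [← TensorProduct.map_mul, hU.row_orthogonal x hw.symm, TensorProduct.map_zero_left]
    · simp
  have hr : (∑ y, TensorProduct.map (U x' y) (U' y z')) * TensorProduct.map (U x' y') 1 =
      TensorProduct.map (U x' y') (U' y' z') := by
    rw [Finset.sum_mul, Finset.sum_eq_single y']
    · rw [← TensorProduct.map_mul, hU.mul_self, mul_one]
    · intro w _ hw
      rw [← TensorProduct.map_mul, hU.row_orthogonal x' hw, TensorProduct.map_zero_left]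
    · simp
  intro h0
  refine TensorProduct.map_ne_zero h h' ?_
  rw [TensorProduct.map_mul, ← hl, ← hr, mul_assoc, ← mul_assoc _ _ (TensorProduct.map _ 1), h0,
    zero_mul, mul_zero]

/-- The product `U x y * U x' y'` intertwines compatible scalar matrices. -/
theorem smul_mul_eq_smul_mul (hU : IsMagicIntertwiner A B U) (x x' : V) (y y' : W) :
    A x x' • (U x y * U x' y') = B y y' • (U x y * U x' y') := by
  -- Column orthogonality keeps only `z = x'` on the left-hand side, row orthogonality only `z = y`
  -- on the right-hand side.
  have h := congr(U x y * $(hU.comm x y') * U x' y')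
  simp only [Finset.mul_sum, Finset.sum_mul, mul_smul_comm, smul_mul_assoc] at h
  rw [Finset.sum_eq_single x', Finset.sum_eq_single y] at h
  · simpa [mul_assoc, hU.mul_self, ← mul_assoc (U x y) (U x y)] using h
  · intro w _ hw
    rw [hU.row_orthogonal x hw.symm, zero_mul, smul_zero]
  · simp
  · intro w _ hw
    rw [mul_assoc, hU.col_orthogonal hw, mul_zero, smul_zero]
  · simp

/-- A magic unitary intertwines scalar matrices whose entries agree wherever it is supported. -/
theorem of_smul_mul_eq_smul_mul (hU : IsMagicIntertwiner A B U) {M : Matrix V V ℂ}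
    {N : Matrix W W ℂ}
    (h : ∀ x x' y y', M x x' • (U x y * U x' y') = N y y' • (U x y * U x' y')) :
    IsMagicIntertwiner M N U where
  proj := hU.proj
  row_sum := hU.row_sum
  col_sum := hU.col_sum
  comm x y := by
    calc ∑ z, M x z • U z y = ∑ z, M x z • ((∑ w, U x w) * U z y) := by
          simp_rw [hU.row_sum, one_mul]
      _ = ∑ w, N w y • (U x w * ∑ z, U z y) := by
          simp_rw [Finset.sum_mul, Finset.mul_sum, Finset.smul_sum, h]
          rw [Finset.sum_comm]
      _ = ∑ w, N w y • U x w := by simp_rw [hU.col_sum, mul_one]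

theorem mul {M : Matrix V V ℂ} {N : Matrix W W ℂ} (hU : IsMagicIntertwiner A B U)
    (hU' : IsMagicIntertwiner M N U) : IsMagicIntertwiner (A * M) (B * N) U where
  proj := hU.proj
  row_sum := hU.row_sum
  col_sum := hU.col_sum
  comm x y := by
    calc ∑ z, (A * M) x z • U z y = ∑ t, A x t • ∑ z, M t z • U z y := by
          simp_rw [Matrix.mul_apply, Finset.sum_smul, Finset.smul_sum, smul_smul]
          rw [Finset.sum_comm]
      _ = ∑ t, N t y • ∑ z, A x z • U z t := by
          simp_rw [hU'.comm, Finset.smul_sum, smul_smul]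
          rw [Finset.sum_comm]
          simp_rw [mul_comm]
      _ = ∑ z, (B * N) z y • U x z := by
          simp_rw [hU.comm, Matrix.mul_apply, Finset.sum_smul, Finset.smul_sum, smul_smul]
          rw [Finset.sum_comm]
          simp_rw [mul_comm]

/-- Magic intertwiners restrict along isometries onto invariant subspaces. -/
theorem restrict (hU : IsMagicIntertwiner A B U) (i : F →ₗᵢ[ℂ] E) {U' : V → W → Module.End ℂ F}
    (h : ∀ x y f, i (U' x y f) = U x y (i f)) : IsMagicIntertwiner A B U' where
  proj x y := by
    refine ⟨LinearMap.ext fun f => i.injective ?_, fun f g => ?_⟩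
    · have := congr($(hU.mul_self x y) (i f))
      simpa [h] using this
    · rw [← i.inner_map_map, ← i.inner_map_map, h, h, (hU.proj x y).isSymmetric]
  row_sum x := LinearMap.ext fun f => i.injective <| by
    simpa [h] using congr($(hU.row_sum x) (i f))
  col_sum y := LinearMap.ext fun f => i.injective <| by
    simpa [h] using congr($(hU.col_sum y) (i f))
  comm x y := LinearMap.ext fun f => i.injective <| by
    simpa [h] using congr($(hU.comm x y) (i f))

end IsMagicIntertwiner
end

/-! ### Reduction to spaces in the lowest universe. -/

noncomputable instance Shrink.instInnerProductSpace {E : Type*} [Small.{v} E]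
    [NormedAddCommGroup E] [InnerProductSpace ℂ E] : InnerProductSpace ℂ (Shrink.{v} E) where
  inner x y := ⟪(equivShrink E).symm x, (equivShrink E).symm y⟫_ℂ
  norm_sq_eq_re_inner x := norm_sq_eq_re_inner (𝕜 := ℂ) ((equivShrink E).symm x)
  conj_inner_symm _ _ := inner_conj_symm _ _
  add_left x y z := by simp
  smul_left x y r := by simp [mul_comm]

/-- The linear isometry from `Shrink E` to `E`. -/
noncomputable def Shrink.toLinearIsometry (E : Type*) [Small.{v} E]
    [NormedAddCommGroup E] [InnerProductSpace ℂ E] : Shrink.{v} E →ₗᵢ[ℂ] E where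
  toLinearMap := (Shrink.linearEquiv ℂ E).toLinearMap
  norm_map' _ := rfl

/-- The smallest subspace which contains `ξ` and is invariant under finitely many operators is
small. -/
theorem exists_small_invariant_submodule {ι : Type*} [Finite ι] {E : Type*} [AddCommGroup E]
    [Module ℂ E] (T : ι → Module.End ℂ E) (ξ : E) :
    ∃ S : Submodule ℂ E, Small.{0} S ∧ ξ ∈ S ∧ ∀ i, ∀ v ∈ S, T i v ∈ S := by
  obtain ⟨n, ⟨e⟩⟩ := Finite.exists_equiv_fin ι
  -- The free algebra on `Fin n` lives in `Type`, so its orbit of `ξ` is small whatever the universe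
  -- of `E`.
  let φ := FreeAlgebra.lift ℂ fun k => T (e.symm k)
  let L : FreeAlgebra ℂ (Fin n) →ₗ[ℂ] E := (LinearMap.applyₗ ξ).comp φ.toLinearMap
  refine ⟨LinearMap.range L, small_of_surjective L.surjective_rangeRestrict,
    ⟨1, by simp [L]⟩, ?_⟩
  rintro i _ ⟨a, rfl⟩
  exact ⟨FreeAlgebra.ι ℂ (e i) * a, by simp [L, φ]⟩

namespace IsMagicIntertwiner

variable {V : Type*} {W : Type*} [Fintype V] [Fintype W]
variable {A : Matrix V V ℂ} {B : Matrix W W ℂ} {E : Type*}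
  [NormedAddCommGroup E] [InnerProductSpace ℂ E] {U : V → W → Module.End ℂ E}

/-- A nonzero product of entries of a magic intertwiner is also nonzero for some magic intertwiner
on a space in the lowest universe. -/
theorem exists_small (hU : IsMagicIntertwiner A B U) {x x' : V} {y y' : W}
    (h : U x y * U x' y' ≠ 0) :
    ∃ (F : Type) (_ : NormedAddCommGroup F) (_ : InnerProductSpace ℂ F)
      (U' : V → W → Module.End ℂ F), IsMagicIntertwiner A B U' ∧ U' x y * U' x' y' ≠ 0 := by
  obtain ⟨ξ, hξ⟩ := DFunLike.ne_iff.mp h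
  obtain ⟨S, hS, hmem, hinv⟩ :=
    exists_small_invariant_submodule (fun p : V × W => U p.1 p.2) ξ
  let e := Shrink.linearEquiv.{0} ℂ S
  let i : Shrink.{0} S →ₗᵢ[ℂ] E := S.subtypeₗᵢ.comp (Shrink.toLinearIsometry S)
  let U' : V → W → Module.End ℂ (Shrink.{0} S) := fun x y =>
    e.symm.toLinearMap ∘ₗ (U x y).restrict (hinv (x, y)) ∘ₗ e.toLinearMap
  have hi : ∀ f, i f = e f := fun _ => rfl
  have key : ∀ x y f, i (U' x y f) = U x y (i f) := fun x y f => by simp [hi, U']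
  refine ⟨_, inferInstance, inferInstance, U', hU.restrict i key, fun h0 => hξ ?_⟩
  have h1 : i (e.symm ⟨ξ, hmem⟩) = ξ := by simp [hi]
  have h2 := congr(i ($h0 (e.symm ⟨ξ, hmem⟩)))
  simpa [key, h1] using h2

end IsMagicIntertwiner

/-! ### Passage between magic intertwiners and magic unitaries on Hilbert spaces. -/

theorem LinearMap.IsSymmetricProjection.norm_apply_le {E : Type*} [NormedAddCommGroup E]
    [InnerProductSpace ℂ E] {P : Module.End ℂ E} (hP : P.IsSymmetricProjection) (v : E) :
    ‖P v‖ ≤ 1 * ‖v‖ := by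
  have h := congr(‖$(hP.inner_map_self v)‖)
  have h' := norm_inner_le_norm (𝕜 := ℂ) (P v) v
  rw [h, Complex.norm_real, Real.norm_of_nonneg (by positivity), sq] at h'
  rw [one_mul]
  by_contra! hlt
  nlinarith [norm_nonneg v]

theorem SimpleGraph.adjMatrix_mul_eq_mul_iff {V : Type*} {W : Type*} [Fintype V] [Fintype W]
    (X : SimpleGraph V) (Y : SimpleGraph W) [DecidableRel X.Adj] [DecidableRel Y.Adj]
    {R : Type*} [Ring R] [Algebra ℂ R] (U : Matrix V W R) :
    X.adjMatrix R * U = U * Y.adjMatrix R ↔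
      ∀ x y, ∑ z, X.adjMatrix ℂ x z • U z y = ∑ z, Y.adjMatrix ℂ z y • U x z := by
  rw [← Matrix.ext_iff]
  refine forall₂_congr fun x y => ?_
  simp only [Matrix.mul_apply, SimpleGraph.adjMatrix_apply]
  simp

theorem IsMagicUnitary.isMagicIntertwiner {V : Type*} {W : Type*} [Fintype V] [Fintype W]
    {X : SimpleGraph V} {Y : SimpleGraph W} [DecidableRel X.Adj] [DecidableRel Y.Adj]
    {H : Type*} [NormedAddCommGroup H] [InnerProductSpace ℂ H] [CompleteSpace H]
    {U : Matrix V W (H →L[ℂ] H)} (hU : IsMagicUnitary U)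
    (hcomm : X.adjMatrix (H →L[ℂ] H) * U = U * Y.adjMatrix (H →L[ℂ] H)) :
    IsMagicIntertwiner (X.adjMatrix ℂ) (Y.adjMatrix ℂ)
      fun x y => (U x y : H →ₗ[ℂ] H) where
  proj x y := ContinuousLinearMap.isStarProjection_iff_isSymmetricProjection.mp (hU.proj x y)
  row_sum x := by ext v; simpa using congr($(hU.row_sum x) v)
  col_sum y := by ext v; simpa using congr($(hU.col_sum y) v)
  comm x y := by
    ext v
    have h := congr($((X.adjMatrix_mul_eq_mul_iff Y U).mp hcomm x y) v)
    simp only [_root_.sum_apply, _root_.smul_apply] at h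
    simpa only [LinearMap.sum_apply, LinearMap.smul_apply] using! h

/-- The entries of a magic intertwiner extend to the completion. -/
theorem IsMagicIntertwiner.exists_qutRep {V : Type*} [Fintype V] {X : SimpleGraph V}
    [DecidableRel X.Adj] {E : Type}
    [NormedAddCommGroup E] [InnerProductSpace ℂ E] {U : V → V → Module.End ℂ E}
    (hU : IsMagicIntertwiner (X.adjMatrix ℂ) (X.adjMatrix ℂ) U) {x x' y y' : V}
    (h : U x y * U x' y' ≠ 0) : ∃ π : QutRep X, π.U x y * π.U x' y' ≠ 0 := by
  let j : E →ₗᵢ[ℂ] UniformSpace.Completion E := UniformSpace.Completion.toComplₗᵢ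
  have hj : ∀ v : E, (v : UniformSpace.Completion E) = j v := fun _ => rfl
  let U' : Matrix V V (UniformSpace.Completion E →L[ℂ] UniformSpace.Completion E) := fun x y =>
    ((U x y).mkContinuous 1 (hU.proj x y).norm_apply_le).completion
  have hU' : ∀ x y v, U' x y (j v) = j (U x y v) :=
    fun x y v => ContinuousLinearMap.completion_apply_coe _ _
  have hext : ∀ {P Q : UniformSpace.Completion E →L[ℂ] UniformSpace.Completion E},
      (∀ v, P (j v) = Q (j v)) → P = Q := fun {P Q} h =>
    ContinuousLinearMap.ext fun v => UniformSpace.Completion.induction_on v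
      (isClosed_eq P.continuous Q.continuous) h
  have hmagic : IsMagicUnitary U' := by
    refine ⟨fun x y => ?_, fun x => hext fun v => ?_, fun y => hext fun v => ?_⟩
    · rw [ContinuousLinearMap.isStarProjection_iff_isSymmetricProjection]
      refine ⟨?_, ?_⟩
      · have h1 : U' x y * U' x y = U' x y := hext fun v => by
          simpa [hU'] using congr(j ($(hU.mul_self x y) v))
        exact congr(($h1 : UniformSpace.Completion E →ₗ[ℂ] UniformSpace.Completion E))
      · intro a b
        refine UniformSpace.Completion.induction_on₂ a b
          (isClosed_eq (by simp; fun_prop) (by simp; fun_prop)) fun a b => ?_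
        simpa [hU', hj] using (hU.proj x y).isSymmetric a b
    · simpa [hU'] using congr(j ($(hU.row_sum x) v))
    · simpa [hU'] using congr(j ($(hU.col_sum y) v))
  have hcomm := (X.adjMatrix_mul_eq_mul_iff X U').mpr fun x y => hext fun v => by
    have h := congr(j ($(hU.comm x y) v))
    simp only [LinearMap.sum_apply, LinearMap.smul_apply, map_sum, map_smul] at h
    simpa only [_root_.sum_apply, _root_.smul_apply, hU'] using h
  obtain ⟨v, hv⟩ := DFunLike.ne_iff.mp h
  have : Nontrivial (UniformSpace.Completion E) :=
    ⟨j _, 0, fun h0 => hv (j.injective (h0.trans (map_zero j).symm))⟩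
  refine ⟨⟨UniformSpace.Completion E, U', hmagic, hcomm⟩, fun h0 => hv (j.injective ?_)⟩
  simpa [hU'] using congr($h0 (j v))

/-! ### Related pairs and compatible matrices. -/

section
variable {V : Type*} {W : Type*} {Z : Type*} [Fintype V] [Fintype W] [Fintype Z]

/-- `(x, x')` and `(y, y')` are related if `U x y * U x' y' ≠ 0` for some magic unitary `U` which
intertwines `A` and `B`. -/
def IntertwinerRel (A : Matrix V V ℂ) (B : Matrix W W ℂ) (p : V × V) (q : W × W) : Prop :=
  ∃ (E : Type) (_ : NormedAddCommGroup E) (_ : InnerProductSpace ℂ E)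
    (U : V → W → Module.End ℂ E), IsMagicIntertwiner A B U ∧ U p.1 q.1 * U p.2 q.2 ≠ 0

/-- The scalar matrices `M` and `N` have the same entries at related pairs. -/
def IntertwinerCompatible (A : Matrix V V ℂ) (B : Matrix W W ℂ) (M : Matrix V V ℂ)
    (N : Matrix W W ℂ) : Prop :=
  ∀ p q, IntertwinerRel A B p q → M p.1 p.2 = N q.1 q.2

variable {A : Matrix V V ℂ} {B : Matrix W W ℂ} {C : Matrix Z Z ℂ}

namespace IntertwinerRel

theorem refl (A : Matrix V V ℂ) (p : V × V) : IntertwinerRel A A p p := by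
  classical
  exact ⟨ℂ, _, inferInstance, _, IsMagicIntertwiner.refl A ℂ, by simp⟩

theorem symm (hA : A.IsSymm) (hB : B.IsSymm) {p : V × V} {q : W × W}
    (h : IntertwinerRel A B p q) : IntertwinerRel B A q p := by
  obtain ⟨E, _, _, U, hU, h⟩ := h
  exact ⟨E, _, _, _, hU.transpose hA hB, h⟩

theorem trans {p : V × V} {q : W × W} {r : Z × Z} (h : IntertwinerRel A B p q)
    (h' : IntertwinerRel B C q r) : IntertwinerRel A C p r := by
  obtain ⟨E, _, _, U, hU, h⟩ := h
  obtain ⟨F, _, _, U', hU', h'⟩ := h'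
  exact ⟨_, inferInstance, inferInstance, _, hU.comp hU', hU.comp_mul_ne_zero h h'⟩

theorem swap {p : V × V} {q : W × W} (h : IntertwinerRel A B p q) :
    IntertwinerRel A B p.swap q.swap := by
  obtain ⟨E, _, _, U, hU, h⟩ := h
  exact ⟨E, _, _, U, hU, fun h0 => h <|
    (hU.proj _ _).isSymmetric.mul_eq_zero_comm (hU.proj _ _).isSymmetric h0⟩

end IntertwinerRel

/-- Expanding `1 * 1 ≠ 0` by the two row sums leaves some nonzero product of entries. -/
theorem IsMagicIntertwiner.exists_intertwinerRel {E : Type*} [NormedAddCommGroup E]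
    [InnerProductSpace ℂ E] [Nontrivial E] {U : V → W → Module.End ℂ E}
    (hU : IsMagicIntertwiner A B U) (p : V × V) : ∃ q, IntertwinerRel A B p q := by
  have h : (∑ y, U p.1 y) * (∑ y, U p.2 y) ≠ 0 := by
    rw [hU.row_sum, hU.row_sum, one_mul]
    exact one_ne_zero
  rw [Finset.sum_mul_sum] at h
  obtain ⟨y, _, h⟩ := Finset.exists_ne_zero_of_sum_ne_zero h
  obtain ⟨y', _, h⟩ := Finset.exists_ne_zero_of_sum_ne_zero h
  exact ⟨(y, y'), hU.exists_small h⟩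

namespace IntertwinerCompatible

variable {M M' : Matrix V V ℂ} {N N' : Matrix W W ℂ}

theorem isMagicIntertwiner (h : IntertwinerCompatible A B M N) {E : Type} [NormedAddCommGroup E]
    [InnerProductSpace ℂ E] {U : V → W → Module.End ℂ E} (hU : IsMagicIntertwiner A B U) :
    IsMagicIntertwiner M N U :=
  hU.of_smul_mul_eq_smul_mul fun x x' y y' => by
    by_cases h0 : U x y * U x' y' = 0
    · simp [h0]
    · rw [h (x, x') (y, y') ⟨E, _, _, U, hU, h0⟩]

/-- Converse of `isMagicIntertwiner`: a nonzero product `U x y * U x' y'` can be cancelled from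
`smul_mul_eq_smul_mul`. This makes compatibility of matrix products accessible. -/
theorem of_forall (h : ∀ (E : Type) [NormedAddCommGroup E] [InnerProductSpace ℂ E]
    (U : V → W → Module.End ℂ E), IsMagicIntertwiner A B U → IsMagicIntertwiner M N U) :
    IntertwinerCompatible A B M N := by
  rintro p q ⟨E, _, _, U, hU, h0⟩
  exact smul_left_injective ℂ h0 ((h E U hU).smul_mul_eq_smul_mul p.1 p.2 q.1 q.2)

theorem self (A : Matrix V V ℂ) (B : Matrix W W ℂ) : IntertwinerCompatible A B A B :=
  of_forall fun _ _ _ _ hU => hU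

theorem one [DecidableEq V] [DecidableEq W] (A : Matrix V V ℂ) (B : Matrix W W ℂ) :
    IntertwinerCompatible A B 1 1 :=
  of_forall fun _ _ _ _ hU => ⟨hU.proj, hU.row_sum, hU.col_sum, by simp [Matrix.one_apply]⟩

theorem mul (h : IntertwinerCompatible A B M N) (h' : IntertwinerCompatible A B M' N') :
    IntertwinerCompatible A B (M * M') (N * N') :=
  of_forall fun _ _ _ _ hU => (h.isMagicIntertwiner hU).mul (h'.isMagicIntertwiner hU)

theorem conjTranspose (h : IntertwinerCompatible A B M N) :
    IntertwinerCompatible A B Mᴴ Nᴴ := fun p q hpq =>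
  congrArg star (h p.swap q.swap hpq.swap)

theorem hadamard (h : IntertwinerCompatible A B M N) (h' : IntertwinerCompatible A B M' N') :
    IntertwinerCompatible A B (M ⊙ M') (N ⊙ N') := fun p q hpq =>
  congrArg₂ (· * ·) (h p q hpq) (h' p q hpq)

/-- Uniqueness of the transported matrix; it reduces each property of the isomorphism to a
compatibility statement. -/
theorem eq_right (hB : ∀ q, ∃ p, IntertwinerRel A B p q) (h : IntertwinerCompatible A B M N)
    (h' : IntertwinerCompatible A B M N') : N = N' := by
  ext y y'
  obtain ⟨p, hp⟩ := hB (y, y')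
  exact (h p _ hp).symm.trans (h' p _ hp)

end IntertwinerCompatible
end

/-! ### The quantum orbital algebra as the algebra of self-compatible matrices. -/

section
variable {V : Type*} [Fintype V] (X : SimpleGraph V) [DecidableRel X.Adj]

theorem quantumOrbitalRel_iff {p q : V × V} : QuantumOrbitalRel X p q ↔
    IntertwinerRel (X.adjMatrix ℂ) (X.adjMatrix ℂ) p q := by
  -- Elements of `C(Qut(X))` are families over all representations, so a product is nonzero when
  -- some coordinate is.
  have h : QuantumOrbitalRel X p q ↔ ∃ π : QutRep X, π.U p.1 q.1 * π.U p.2 q.2 ≠ 0 := by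
    rw [QuantumOrbitalRel, ← not_forall_not, not_iff_not]
    simp only [ne_eq, not_not]
    exact ⟨fun h π => congr(($h).1.1 π), fun h => Subtype.ext <| Subtype.ext <| funext h⟩
  rw [h]
  constructor
  · rintro ⟨π, h⟩
    refine ⟨π.H, _, _, _, π.magic.isMagicIntertwiner π.comm, fun h0 => h ?_⟩
    ext v
    exact congr($h0 v)
  · rintro ⟨E, _, _, U, hU, h⟩
    exact hU.exists_qutRep h

/-- Since `u x y` is idempotent, orbits are the orbitals of diagonal pairs. -/
theorem quantumOrbitRel_iff {x y : V} : QuantumOrbitRel X x y ↔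
    IntertwinerRel (X.adjMatrix ℂ) (X.adjMatrix ℂ) (x, x) (y, y) := by
  rw [← quantumOrbitalRel_iff, QuantumOrbitRel, QuantumOrbitalRel, not_iff_not]
  have h : qutMatrix X x y * qutMatrix X x y = qutMatrix X x y :=
    Subtype.ext <| Subtype.ext <| funext fun π => (π.magic.proj x y).isIdempotentElem
  rw [h]

theorem mem_quantumOrbitalAlgebra_iff {M : Matrix V V ℂ} : M ∈ quantumOrbitalAlgebra X ↔
    IntertwinerCompatible (X.adjMatrix ℂ) (X.adjMatrix ℂ) M M := by
  classical
  have hs := X.isSymm_adjMatrix (α := ℂ)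
  constructor
  · intro hM p q hpq
    induction hM using Submodule.span_induction with
    | mem M hM =>
      obtain ⟨_, ⟨r, rfl⟩, rfl⟩ := hM
      have h : QuantumOrbitalRel X r p ↔ QuantumOrbitalRel X r q := by
        simp only [quantumOrbitalRel_iff]
        exact ⟨fun h => h.trans hpq, fun h => h.trans (hpq.symm hs hs)⟩
      simp [charMatrix, Set.indicator, h]
    | zero => rfl
    | add M N _ _ hM hN => simp [hM, hN]
    | smul c M _ hM => simp [hM]
  · intro hM
    -- `n p` is the size of the orbital of `p`. The sum below runs over pairs, so each orbital
    -- occurs once per member; dividing by `n p` corrects this.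
    let n : V × V → ℂ := fun p => (Finset.univ.filter fun q => QuantumOrbitalRel X p q).card
    have hn : ∀ p, n p ≠ 0 := fun p => by
      simp only [n, ne_eq, Nat.cast_eq_zero, Finset.card_eq_zero]
      exact Finset.ne_empty_of_mem (a := p)
        (by simpa using (quantumOrbitalRel_iff X).mpr (.refl _ p))
    have h : M = ∑ p : V × V, (M p.1 p.2 / n p) • charMatrix {q | QuantumOrbitalRel X p q} := by
      ext x x'
      have hterm : ∀ p : V × V,
          ((M p.1 p.2 / n p) • charMatrix {q | QuantumOrbitalRel X p q}) x x' =
            if QuantumOrbitalRel X (x, x') p then M x x' / n (x, x') else 0 := by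
        intro p
        simp only [charMatrix, Matrix.smul_apply, Matrix.of_apply, Set.indicator, Set.mem_ofPred_eq,
          quantumOrbitalRel_iff]
        by_cases hp : IntertwinerRel (X.adjMatrix ℂ) (X.adjMatrix ℂ) p (x, x')
        · have hn' : n p = n (x, x') := by
            simp only [n, quantumOrbitalRel_iff]
            congr 2
            ext q
            simpa using ⟨fun h => (hp.symm hs hs).trans h, fun h => hp.trans h⟩
          simp [hp, hp.symm hs hs, hM _ _ hp, hn']
        · have hp' : ¬IntertwinerRel (X.adjMatrix ℂ) (X.adjMatrix ℂ) (x, x') p :=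
            fun h => hp (h.symm hs hs)
          rw [if_neg hp, if_neg hp', smul_zero]
      rw [Matrix.sum_apply, Finset.sum_congr rfl fun p _ => hterm p, ← Finset.sum_filter,
        Finset.sum_const, nsmul_eq_mul]
      exact (mul_div_cancel₀ _ (hn (x, x'))).symm
    rw [h]
    exact Submodule.sum_mem _ fun p _ => Submodule.smul_mem _ _
      (Submodule.subset_span ⟨_, ⟨p, rfl⟩, rfl⟩)

theorem isCoherentAlgebra_quantumOrbitalAlgebra [DecidableEq V] :
    IsCoherentAlgebra (quantumOrbitalAlgebra X) := by
  constructor <;> simp only [mem_quantumOrbitalAlgebra_iff]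
  · exact .one _ _
  · exact fun _ _ _ => rfl
  · exact .mul
  · exact .conjTranspose
  · exact .hadamard

theorem adjMatrix_mem_quantumOrbitalAlgebra : X.adjMatrix ℂ ∈ quantumOrbitalAlgebra X :=
  (mem_quantumOrbitalAlgebra_iff X).mpr (.self _ _)

end

/-! ### Comparison of the two graphs. -/

section
variable {V : Type*} {W : Type*} [Fintype V] [Fintype W] (X : SimpleGraph V) (Y : SimpleGraph W)
  [DecidableRel X.Adj] [DecidableRel Y.Adj]

/-- If every pair of vertices of either graph is related to a pair of vertices of the other one,
then compatibility is a linear bijection between the quantum orbital algebras. -/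
theorem exists_quantumOrbitalAlgebra_equiv
    (hX : ∀ p, ∃ q, IntertwinerRel (X.adjMatrix ℂ) (Y.adjMatrix ℂ) p q)
    (hY : ∀ q, ∃ p, IntertwinerRel (X.adjMatrix ℂ) (Y.adjMatrix ℂ) p q) :
    ∃ Φ : quantumOrbitalAlgebra X ≃ₗ[ℂ] quantumOrbitalAlgebra Y,
      ∀ M, IntertwinerCompatible (X.adjMatrix ℂ) (Y.adjMatrix ℂ) M.1 (Φ M).1 := by
  have hsX := X.isSymm_adjMatrix (α := ℂ)
  have hsY := Y.isSymm_adjMatrix (α := ℂ)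
  choose f hf using hX
  choose g hg using hY
  -- The entry at a pair is read off at a chosen partner. Any two partners lie in the same orbital,
  -- where `M` is constant, so the choice is immaterial.
  let Φ : quantumOrbitalAlgebra X →ₗ[ℂ] quantumOrbitalAlgebra Y :=
    { toFun M := ⟨Matrix.of fun y y' => M.1 (g (y, y')).1 (g (y, y')).2,
        (mem_quantumOrbitalAlgebra_iff Y).mpr fun p q hpq =>
          (mem_quantumOrbitalAlgebra_iff X).mp M.2 _ _
            (((hg p).trans hpq).trans ((hg q).symm hsX hsY))⟩
      map_add' _ _ := rfl
      map_smul' _ _ := rfl }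
  let Ψ : quantumOrbitalAlgebra Y →ₗ[ℂ] quantumOrbitalAlgebra X :=
    { toFun N := ⟨Matrix.of fun x x' => N.1 (f (x, x')).1 (f (x, x')).2,
        (mem_quantumOrbitalAlgebra_iff X).mpr fun p q hpq =>
          (mem_quantumOrbitalAlgebra_iff Y).mp N.2 _ _
            ((((hf p).symm hsX hsY).trans hpq).trans (hf q))⟩
      map_add' _ _ := rfl
      map_smul' _ _ := rfl }
  refine ⟨LinearEquiv.ofLinearMap Φ Ψ ?_ ?_, fun M p q hpq => ?_⟩
  · ext N y y'
    exact (mem_quantumOrbitalAlgebra_iff Y).mp N.2 _ (y, y')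
      (((hf _).symm hsX hsY).trans (hg (y, y')))
  · ext M x x'
    exact (mem_quantumOrbitalAlgebra_iff X).mp M.2 _ (x, x')
      ((hg _).trans ((hf (x, x')).symm hsX hsY))
  · exact (mem_quantumOrbitalAlgebra_iff X).mp M.2 _ _ (hpq.trans ((hg q).symm hsX hsY))

theorem ncard_quantumOrbits_eq
    (hX : ∀ p, ∃ q, IntertwinerRel (X.adjMatrix ℂ) (Y.adjMatrix ℂ) p q)
    (hY : ∀ q, ∃ p, IntertwinerRel (X.adjMatrix ℂ) (Y.adjMatrix ℂ) p q) :
    (quantumOrbits X).ncard = (quantumOrbits Y).ncard := by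
  classical
  have hsX := X.isSymm_adjMatrix (α := ℂ)
  have hsY := Y.isSymm_adjMatrix (α := ℂ)
  let T : V → W → Prop := fun x y =>
    IntertwinerRel (X.adjMatrix ℂ) (Y.adjMatrix ℂ) (x, x) (y, y)
  -- Compatibility of the identity matrices forces partners of diagonal pairs to be diagonal.
  have hdiag := IntertwinerCompatible.one (X.adjMatrix ℂ) (Y.adjMatrix ℂ)
  have hTX : ∀ x, ∃ y, T x y := fun x => by
    obtain ⟨⟨y, y'⟩, h⟩ := hX (x, x)
    obtain rfl : y = y' := by simpa [Matrix.one_apply] using hdiag _ _ h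
    exact ⟨y, h⟩
  have hTY : ∀ y, ∃ x, T x y := fun y => by
    obtain ⟨⟨x, x'⟩, h⟩ := hY (y, y)
    obtain rfl : x = x' := by simpa [Matrix.one_apply] using hdiag _ _ h
    exact ⟨x, h⟩
  let K : Set V → Set W := fun S => {y | ∃ x ∈ S, T x y}
  have hK : ∀ x y, T x y → K {x' | QuantumOrbitRel X x x'} = {y' | QuantumOrbitRel Y y y'} := by
    intro x y hxy
    ext y'
    simp only [K, Set.mem_ofPred_eq, quantumOrbitRel_iff]
    exact ⟨fun ⟨x', h, h'⟩ => ((hxy.symm hsX hsY).trans h).trans h',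
      fun h => ⟨x, .refl _ _, hxy.trans h⟩⟩
  have himage : K '' quantumOrbits X = quantumOrbits Y := by
    ext S
    constructor
    · rintro ⟨_, ⟨x, rfl⟩, rfl⟩
      obtain ⟨y, hxy⟩ := hTX x
      exact ⟨y, (hK x y hxy).symm⟩
    · rintro ⟨y, rfl⟩
      obtain ⟨x, hxy⟩ := hTY y
      exact ⟨_, ⟨x, rfl⟩, hK x y hxy⟩
  -- For injectivity: if the images of the orbits of `x` and `x'` agree, a partner `y` of `x` is
  -- also a partner of some `z` in the orbit of `x'`, which links `x'` to `x`.
  rw [← himage, Set.InjOn.ncard_image]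
  rintro _ ⟨x, rfl⟩ _ ⟨x', rfl⟩ h
  obtain ⟨y, hxy⟩ := hTX x
  have hy : y ∈ K {z | QuantumOrbitRel X x z} :=
    ⟨x, (quantumOrbitRel_iff X).mpr (.refl _ _), hxy⟩
  rw [h] at hy
  obtain ⟨z, hz, hzy⟩ := hy
  have hxx' := ((quantumOrbitRel_iff X).mp hz).trans (hzy.trans (hxy.symm hsX hsY))
  ext t
  simp only [Set.mem_ofPred_eq, quantumOrbitRel_iff]
  exact ⟨fun h => hxx'.trans h, fun h => (hxx'.symm hsX hsX).trans h⟩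

end

theorem theorem4p8 {V : Type u} {W : Type v} [Fintype V] [DecidableEq V]
    [Fintype W] [DecidableEq W] (X : SimpleGraph V) (Y : SimpleGraph W)
    [DecidableRel X.Adj] [DecidableRel Y.Adj]
    (hXY : QuantumIsomorphic.{u, v, w} X Y) :
    (∃ (hC : IsCoherentAlgebra (quantumOrbitalAlgebra X))
        (hD : IsCoherentAlgebra (quantumOrbitalAlgebra Y))
        (Φ : quantumOrbitalAlgebra X ≃ₗ[ℂ] quantumOrbitalAlgebra Y)
        (hA : X.adjMatrix ℂ ∈ quantumOrbitalAlgebra X)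
        (hB : Y.adjMatrix ℂ ∈ quantumOrbitalAlgebra Y),
        IsCoherentAlgebraIso hC hD Φ ∧ Φ ⟨X.adjMatrix ℂ, hA⟩ = ⟨Y.adjMatrix ℂ, hB⟩) ∧
      (quantumOrbits X).ncard = (quantumOrbits Y).ncard := by
  obtain ⟨H, _, _, _, _, U, hU, hcomm⟩ := hXY
  have hU' := hU.isMagicIntertwiner hcomm
  have hsX := X.isSymm_adjMatrix (α := ℂ)
  have hsY := Y.isSymm_adjMatrix (α := ℂ)
  have hX := hU'.exists_intertwinerRel
  have hY : ∀ q, ∃ p, IntertwinerRel (X.adjMatrix ℂ) (Y.adjMatrix ℂ) p q := fun q =>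
    ((hU'.transpose hsX hsY).exists_intertwinerRel q).imp fun _ h => h.symm hsY hsX
  obtain ⟨Φ, hΦ⟩ := exists_quantumOrbitalAlgebra_equiv X Y hX hY
  have key : ∀ {M N}, IntertwinerCompatible (X.adjMatrix ℂ) (Y.adjMatrix ℂ) M.1 N.1 → Φ M = N :=
    fun {M N} h => Subtype.ext ((hΦ M).eq_right hY h)
  exact ⟨⟨isCoherentAlgebra_quantumOrbitalAlgebra X, isCoherentAlgebra_quantumOrbitalAlgebra Y, Φ,
    adjMatrix_mem_quantumOrbitalAlgebra X, adjMatrix_mem_quantumOrbitalAlgebra Y,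
    ⟨fun M N => key ((hΦ M).mul (hΦ N)), fun M => key (hΦ M).conjTranspose,
      fun M N => key ((hΦ M).hadamard (hΦ N)), key (.one _ _), key fun _ _ _ => rfl⟩,
    key (.self _ _)⟩, ncard_quantumOrbits_eq X Y hX hY⟩
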